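/- Theorem (Adaptive Majorization Minimality). Let $n,m\in\mathbb N$ and $q>0$. An online node is a pair $(N,p)$ of a non-empty set $N\subseteq[n]$ and a quantity $p>0$; its set of feasible allocations is $\Delta(N,p)=\{x\in\mathbb R_{\ge0}^n : x(i)=0 \text{ for } i\notin N,\ \sum_i x(i)=p\}$. Let $\mathcal E_{n,m,q}$ be the set of (oblivious) request sequences $E=((N_t,q_t))_{t\in[m]}$ of online nodes with $\sum_t q_t=q$. For $x,y\in\mathbb R_{\ge 0}^n$ write $x\succeq y$ ($x$ majorizes $y$) if $\sum_i x(i)=\sum_i y(i)$ and, for every $j\in[n]$, the sum of the $j$ largest entries of $x$ is at least the sum of the $j$ largest entries of $y$. $\mathrm{OPT}(E)$ denotes the load vector in $\Delta(E)=\{\sum_t x_t : x_t\in\Delta(N_t,q_t)\}$ that is majorized by every element of $\Delta(E)$. $\mathrm{WF}(E)=\ell_m$ denotes the final load vector of water-filling: $\ell_0=0$ and $\ell_t=\ell_{t-1}+x_t$, where $x_t$ is the (unique) maximizer of $\min_{i\in N_t}(x(i)+\ell_{t-1}(i))$ over $x\in\Delta(N_t,q_t)$. A randomized policy $\mathcal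 A$ assigns (measurably) to each history of past online nodes and allocations and each arriving online node $(N,p)$ a probability distribution on $\Delta(N,p)$. An adaptive request sequence $E'$ with $m$ online nodes chooses (measurably) the $t$-th online node, $t\in[m]$, from the history of the previous $t-1$ online nodes and allocations; it belongs to $\mathcal E_{n,m,q}$ if on every play with feasible allocations the total quantity of its $m$ online nodes is $q$. When $\mathcal A$ plays against $E'$, this generates a random static request sequence $((N_t',q_t'))_{t\in[m]}$ and random allocations $(x_t)_{t\in[m]}$; put $\mathcal A(E')=\sum_t x_t$ and $\mathrm{OPT}(\mathcal A,E')=\mathrm{OPT}(((N_t',q_t'))_{t\in[m]})$. Then for every randomized policy $\mathcal A$ and every oblivious request sequence $E\in\mathcal E_{n,m,q}$ there is an adaptive request sequence $E'\in\mathcal E_{n,m,q}$ such that, with probability $1$, $$\mathrm{WF}(E)\preceq\mathcal A(E')\qquad\text{and}\qquad \mathrm{OPT}(E)\succeq\mathrm{OPT}(\mathcal A,E').$$ -/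

import Mathlib

open MeasureTheory ProbabilityTheory

namespace OnlineAllocation

noncomputable section

/-! ### Majorization -/

/-- The decreasing rearrangement `x↓` of a vector: `sortedDesc x i` is the `(i+1)`-st largest
entry of `x`. -/
def sortedDesc {n : ℕ} (x : Fin n → ℝ) (i : Fin n) : ℝ := x (Tuple.sort x i.rev)

/-- `Majorizes x y` is `x ⪰ y`: the totals agree and the partial sums of `x↓` dominate those
of `y↓`. -/
def Majorizes {n : ℕ} (x y : Fin n → ℝ) : Prop :=
  ∑ i, x i = ∑ i, y i ∧
    ∀ j : Fin n, ∑ i ∈ Finset.Iic j, sortedDesc y i ≤ ∑ i ∈ Finset.Iic j, sortedDesc x i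

/-! ### Online nodes, request sequences, feasible allocations -/

/-- An online node: a non-empty set of compatible offline nodes and a positive quantity. -/
structure Request (n : ℕ) where
  nbrs : Finset (Fin n)
  quantity : ℝ
  nonempty : nbrs.Nonempty
  pos : 0 < quantity

/-- The σ-algebra on online nodes: discrete in the neighbourhood, Borel in the quantity. -/
instance (n : ℕ) : MeasurableSpace (Request n) :=
  MeasurableSpace.comap Request.nbrs ⊤ ⊔ MeasurableSpace.comap Request.quantity inferInstance

/-- `Δ(N, q)`: the feasible allocations of an online node. -/
def Request.feasible {n : ℕ} (r : Request n) : Set (Fin n → ℝ) :=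
  {x | (∀ i, 0 ≤ x i) ∧ (∀ i, i ∉ r.nbrs → x i = 0) ∧ ∑ i, x i = r.quantity}

/-- An (oblivious) request sequence with `n` offline and `m` online nodes. -/
abbrev RequestSeq (n m : ℕ) := Fin m → Request n

/-- The total quantity of a request sequence. -/
def RequestSeq.total {n m : ℕ} (E : RequestSeq n m) : ℝ := ∑ t, (E t).quantity

/-- `Δ(E)`, the Minkowski sum of the `Δ(N_t, q_t)`: the feasible load vectors of `E`. -/
def RequestSeq.loads {n m : ℕ} (E : RequestSeq n m) : Set (Fin n → ℝ) :=
  {l | ∃ x : Fin m → Fin n → ℝ, (∀ t, x t ∈ (E t).feasible) ∧ l = ∑ t, x t}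

theorem Request.feasible_nonempty {n : ℕ} (r : Request n) : r.feasible.Nonempty := by
  obtain ⟨k, hk⟩ := r.nonempty
  refine ⟨Pi.single k r.quantity, fun i => ?_, fun i hi => ?_, by simp⟩
  · by_cases h : i = k
    · subst h; simpa using r.pos.le
    · simp [h]
  · have : i ≠ k := by rintro rfl; exact hi hk
    simp [this]

theorem Request.feasible_isCompact {n : ℕ} (r : Request n) : IsCompact r.feasible := by
  have hcl : IsClosed r.feasible := by
    have h1 : IsClosed {x : Fin n → ℝ | ∀ i, 0 ≤ x i} := by
      rw [Set.ofPred_forall]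
      exact isClosed_iInter fun i => isClosed_le continuous_const (continuous_apply i)
    have h2 : IsClosed {x : Fin n → ℝ | ∀ i, i ∉ r.nbrs → x i = 0} := by
      simp only [Set.ofPred_forall]
      exact isClosed_iInter fun i => isClosed_iInter fun _ =>
        isClosed_eq (continuous_apply i) continuous_const
    have h3 : IsClosed {x : Fin n → ℝ | ∑ i, x i = r.quantity} :=
      isClosed_eq (by fun_prop) continuous_const
    exact h1.inter (h2.inter h3)
  refine (isCompact_Icc (a := (0 : Fin n → ℝ)) (b := fun _ => r.quantity)).of_isClosed_subset
    hcl fun x hx => ⟨fun i => hx.1 i, fun i => ?_⟩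
  rw [← hx.2.2]
  exact Finset.single_le_sum (fun j _ => hx.1 j) (Finset.mem_univ i)

/-! ### Water-filling -/

/-- The least resulting load among the neighbours of `r` when `x` is added to the load `l`. -/
def Request.minLoad {n : ℕ} (r : Request n) (l x : Fin n → ℝ) : ℝ :=
  r.nbrs.inf' r.nonempty fun i => x i + l i

theorem exists_waterFillingStep {n : ℕ} (r : Request n) (l : Fin n → ℝ) :
    ∃ x, x ∈ r.feasible ∧ ∀ y ∈ r.feasible, r.minLoad l y ≤ r.minLoad l x := by
  have hc : Continuous (r.minLoad l) :=
    Continuous.finset_inf'_apply r.nonempty fun i _ => by fun_prop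
  obtain ⟨x, hx, h⟩ := r.feasible_isCompact.exists_isMaxOn r.feasible_nonempty hc.continuousOn
  exact ⟨x, hx, fun y hy => h hy⟩

/-- `WF(N_t, q_t, ℓ)`: the feasible allocation which maximizes the least resulting load among
the neighbours (it is unique, see `waterFillingStep_unique`). -/
def waterFillingStep {n : ℕ} (r : Request n) (l : Fin n → ℝ) : Fin n → ℝ :=
  Classical.choose (exists_waterFillingStep r l)

theorem waterFillingStep_unique {n : ℕ} (r : Request n) (l x : Fin n → ℝ)
    (hx : x ∈ r.feasible) (hmax : ∀ y ∈ r.feasible, r.minLoad l y ≤ r.minLoad l x) :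
    x = waterFillingStep r l := by
  have key : ∀ x y : Fin n → ℝ, x ∈ r.feasible → y ∈ r.feasible →
      r.minLoad l x = r.minLoad l y →
      (∀ z ∈ r.feasible, r.minLoad l z ≤ r.minLoad l x) → ∀ i, y i ≤ x i := by
    intro x y hx hy hxy hm i
    by_contra! hi
    have hiN : i ∈ r.nbrs := by
      by_contra h
      rw [hx.2.1 i h, hy.2.1 i h] at hi
      exact lt_irrefl _ hi
    have hk : (0 : ℝ) < r.nbrs.card := by exact_mod_cast r.nonempty.card_pos
    set c : ℝ := (y i - x i) / (2 * r.nbrs.card) with hc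
    have hcpos : 0 < c := div_pos (by linarith) (by positivity)
    -- the pointwise minimum of `x` and `y`, with the missing quantity spread evenly
    set s : ℝ := ∑ k, (x k - min (x k) (y k)) with hs
    have hspos : 0 < s := by
      have h0 : ∑ k, (x k - y k) = 0 := by
        rw [Finset.sum_sub_distrib, hx.2.2, hy.2.2, sub_self]
      have h1 : s = ∑ k, (y k - min (x k) (y k)) := by
        rw [hs, ← sub_eq_zero, ← Finset.sum_sub_distrib, ← h0]
        exact Finset.sum_congr rfl fun k _ => by ring
      rw [h1]
      refine Finset.sum_pos' (fun k _ => by simp) ⟨i, Finset.mem_univ i, ?_⟩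
      rw [min_eq_left hi.le]; linarith
    set z : Fin n → ℝ := fun k => min (x k) (y k) + if k ∈ r.nbrs then s / r.nbrs.card else 0
    have hz : z ∈ r.feasible := by
      refine ⟨fun k => ?_, fun k hkN => ?_, ?_⟩
      · have := le_min (hx.1 k) (hy.1 k)
        by_cases h : k ∈ r.nbrs <;> simp only [z, h, if_true, if_false] <;> positivity
      · simp [z, hkN, hx.2.1 k hkN, hy.2.1 k hkN]
      · have : ∑ k, (if k ∈ r.nbrs then s / r.nbrs.card else 0) = s := by
          rw [Finset.sum_ite_mem, Finset.univ_inter, Finset.sum_const, nsmul_eq_mul]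
          field_simp
        simp only [z]
        rw [Finset.sum_add_distrib, this, hs, Finset.sum_sub_distrib, hx.2.2]
        ring
    have hlt : r.minLoad l x < r.minLoad l z := by
      refine (Finset.lt_inf'_iff _).2 fun k hkN => ?_
      have h1 : r.minLoad l x ≤ x k + l k := Finset.inf'_le _ hkN
      have h2 : r.minLoad l x ≤ y k + l k := hxy ▸ Finset.inf'_le (fun i => y i + l i) hkN
      have h3 : r.minLoad l x - l k ≤ min (x k) (y k) := le_min (by linarith) (by linarith)
      have h4 : 0 < s / r.nbrs.card := by positivity
      simp only [z, hkN, if_true]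
      linarith
    exact absurd (hm z hz) (not_le.2 hlt)
  have hw := Classical.choose_spec (exists_waterFillingStep r l)
  have he := le_antisymm (hw.2 x hx) (hmax _ hw.1)
  funext i
  exact le_antisymm (key _ x hw.1 hx he.symm hw.2 i) (key x _ hx hw.1 he hmax i)

/-- `WF(E)`: the final load vector of water-filling, started from zero load and run through
the online nodes in order. -/
def waterFilling {n m : ℕ} (E : RequestSeq n m) : Fin n → ℝ :=
  Fin.foldl m (fun l t => l + waterFillingStep (E t) l) 0

/-! ### The hindsight optimum -/

theorem sum_sortedDesc {n : ℕ} (x : Fin n → ℝ) (f : ℝ → ℝ) :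
    ∑ i, f (sortedDesc x i) = ∑ i, f (x i) :=
  Equiv.sum_comp (Fin.revPerm.trans (Tuple.sort x)) fun i => f (x i)

theorem sortedDesc_antitone {n : ℕ} (x : Fin n → ℝ) : Antitone (sortedDesc x) :=
  fun _ _ h => Tuple.monotone_sort x (Fin.rev_le_rev.2 h)

theorem majorizes_of_threshold {n : ℕ} (x y : Fin n → ℝ) (hsum : ∑ i, x i = ∑ i, y i)
    (h : ∀ c : ℝ, ∑ i, max (y i - c) 0 ≤ ∑ i, max (x i - c) 0) : Majorizes x y := by
  refine ⟨hsum, fun j => ?_⟩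
  have hc := h (sortedDesc x j)
  set c := sortedDesc x j
  have h1 : ∑ i ∈ Finset.Iic j, (sortedDesc y i - c) ≤ ∑ i, max (y i - c) 0 := by
    rw [← sum_sortedDesc y fun v => max (v - c) 0]
    exact (Finset.sum_le_sum fun i _ => le_max_left _ _).trans
      (Finset.sum_le_univ_sum_of_nonneg fun i => le_max_right _ _)
  have h2 : ∑ i, max (x i - c) 0 = ∑ i ∈ Finset.Iic j, (sortedDesc x i - c) := by
    rw [← sum_sortedDesc x fun v => max (v - c) 0]
    rw [← Finset.sum_subset (Finset.subset_univ (Finset.Iic j))]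
    · refine Finset.sum_congr rfl fun i hi => max_eq_left ?_
      exact sub_nonneg.2 (sortedDesc_antitone x (Finset.mem_Iic.1 hi))
    · intro i _ hi
      refine max_eq_right (sub_nonpos.2 (sortedDesc_antitone x ?_))
      exact (not_le.1 fun h => hi (Finset.mem_Iic.2 h)).le
  have h3 := (h1.trans hc).trans h2.le
  rw [Finset.sum_sub_distrib, Finset.sum_sub_distrib] at h3
  linarith

/-- Every request sequence has a feasible load vector that is majorized by all the others. -/
theorem exists_opt {n m : ℕ} (E : RequestSeq n m) :
    ∃ l, l ∈ E.loads ∧ ∀ l' ∈ E.loads, Majorizes l' l := by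
  have hcomp : IsCompact (Set.univ.pi fun t => (E t).feasible) :=
    isCompact_univ_pi fun t => (E t).feasible_isCompact
  have hne : (Set.univ.pi fun t => (E t).feasible).Nonempty :=
    Set.univ_pi_nonempty_iff.2 fun t => (E t).feasible_nonempty
  have hcont : Continuous fun x : Fin m → Fin n → ℝ => ∑ i, (∑ t, x t i) ^ 2 := by fun_prop
  obtain ⟨x, hx, hmin⟩ := hcomp.exists_isMinOn hne hcont.continuousOn
  have hx' : ∀ t, x t ∈ (E t).feasible := fun t => hx t (Set.mem_univ t)
  set l : Fin n → ℝ := fun i => ∑ t, x t i with hl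
  have hlx : l = ∑ t, x t := by funext i; simp [hl]
  have hex : ∀ t i j, 0 < x t i → j ∈ (E t).nbrs → l i ≤ l j := by
    intro t i j hi hj
    by_contra! hlt
    have hij : i ≠ j := by rintro rfl; exact lt_irrefl _ hlt
    have hiN : i ∈ (E t).nbrs := by
      by_contra h
      rw [(hx' t).2.1 i h] at hi
      exact lt_irrefl _ hi
    obtain ⟨e, he0, he1, he2⟩ : ∃ e : ℝ, 0 < e ∧ e ≤ x t i ∧ e < l i - l j :=
      ⟨min (x t i) ((l i - l j) / 2), lt_min hi (by linarith), min_le_left _ _,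
        (min_le_right _ _).trans_lt (by linarith)⟩
    set d : Fin n → ℝ := Pi.single j e - Pi.single i e with hd
    have hdi : d i = -e := by simp [hd, hij]
    have hdj : d j = e := by simp [hd, hij.symm]
    have hd0 : ∀ k, k ≠ i → k ≠ j → d k = 0 := fun k h1 h2 => by simp [hd, h1, h2]
    have hfe : x t + d ∈ (E t).feasible := by
      refine ⟨fun k => ?_, fun k hk => ?_, ?_⟩
      · have := (hx' t).1 k
        rcases eq_or_ne k i with rfl | h1
        · simp only [Pi.add_apply, hdi]; linarith
        · rcases eq_or_ne k j with rfl | h2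
          · simp only [Pi.add_apply, hdj]; linarith
          · simpa [hd0 k h1 h2] using this
      · have h1 : k ≠ i := by rintro rfl; exact hk hiN
        have h2 : k ≠ j := by rintro rfl; exact hk hj
        simp [hd0 k h1 h2, (hx' t).2.1 k hk]
      · simp [Finset.sum_add_distrib, hd, (hx' t).2.2]
    have hup : Function.update x t (x t + d) ∈ Set.univ.pi fun t => (E t).feasible := by
      intro s _
      rcases eq_or_ne s t with rfl | h
      · simpa using hfe
      · simpa [h] using hx' s
    have hval : ∀ k, ∑ s, Function.update x t (x t + d) s k = l k + d k := by
      intro k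
      have : ∀ s, Function.update x t (x t + d) s k = x s k + if s = t then d k else 0 := by
        intro s
        rcases eq_or_ne s t with rfl | h
        · simp
        · simp [h]
      simp [this, Finset.sum_add_distrib, hl]
    have hle : ∑ k, l k ^ 2 ≤ ∑ k, (l k + d k) ^ 2 := by
      have := hmin hup
      simp only [Set.mem_ofPred_eq, hval] at this
      exact this
    have h1 : ∑ k, (l k + d k) ^ 2 = ∑ k, l k ^ 2 + ∑ k, (2 * l k + d k) * d k := by
      rw [← Finset.sum_add_distrib]
      exact Finset.sum_congr rfl fun k _ => by ring
    have h2 : ∑ k, (2 * l k + d k) * d k = (2 * l j + e) * e - (2 * l i - e) * e := by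
      have : ∀ k, (2 * l k + d k) * d k =
          (2 * l k + d k) * (Pi.single j e : Fin n → ℝ) k -
            (2 * l k + d k) * (Pi.single i e : Fin n → ℝ) k := fun k => by
        rw [← mul_sub]; rfl
      simp only [this, Finset.sum_sub_distrib, Pi.single_apply, mul_ite, mul_zero,
        Finset.sum_ite_eq', Finset.mem_univ, if_true, hdi, hdj]
      ring
    nlinarith
  refine ⟨l, ⟨x, hx', hlx⟩, ?_⟩
  rintro l' ⟨y, hy, rfl⟩
  have htot : ∀ z : Fin m → Fin n → ℝ, (∀ t, z t ∈ (E t).feasible) →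
      ∑ i, (∑ t, z t) i = ∑ t, (E t).quantity := by
    intro z hz
    simp only [Finset.sum_apply]
    rw [Finset.sum_comm]
    exact Finset.sum_congr rfl fun t _ => (hz t).2.2
  refine majorizes_of_threshold _ _ (by rw [hlx, htot y hy, htot x hx']) fun c => ?_
  set L : Finset (Fin n) := Finset.univ.filter fun i => c < l i with hL
  have hmem : ∀ i, i ∈ L ↔ c < l i := fun i => by simp [hL]
  have h1 : ∑ i, max (l i - c) 0 = ∑ i ∈ L, (l i - c) := by
    rw [← Finset.sum_subset (Finset.subset_univ L)]
    · exact Finset.sum_congr rfl fun i hi => max_eq_left (sub_nonneg.2 ((hmem i).1 hi).le)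
    · exact fun i _ hi => max_eq_right (sub_nonpos.2 (not_lt.1 fun h => hi ((hmem i).2 h)))
  have h2 : ∑ i ∈ L, l i ≤ ∑ i ∈ L, (∑ t, y t) i := by
    simp only [Finset.sum_apply, hl]
    rw [Finset.sum_comm, Finset.sum_comm (s := L)]
    refine Finset.sum_le_sum fun t _ => ?_
    by_cases h : ∃ i ∈ L, 0 < x t i
    · obtain ⟨i, hi, hpos⟩ := h
      have hsub : (E t).nbrs ⊆ L := fun j hj =>
        (hmem j).2 (((hmem i).1 hi).trans_le (hex t i j hpos hj))
      have hyq : ∑ i ∈ L, y t i = (E t).quantity := by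
        rw [← (hy t).2.2]
        exact Finset.sum_subset (Finset.subset_univ L) fun j _ hj =>
          (hy t).2.1 j fun h => hj (hsub h)
      rw [hyq, ← (hx' t).2.2]
      exact Finset.sum_le_univ_sum_of_nonneg (hx' t).1
    · push Not at h
      exact (Finset.sum_nonpos h).trans (Finset.sum_nonneg fun i _ => (hy t).1 i)
  rw [h1]
  calc ∑ i ∈ L, (l i - c) ≤ ∑ i ∈ L, ((∑ t, y t) i - c) := by
        rw [Finset.sum_sub_distrib, Finset.sum_sub_distrib]; linarith
    _ ≤ ∑ i ∈ L, max ((∑ t, y t) i - c) 0 := Finset.sum_le_sum fun i _ => le_max_left _ _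
    _ ≤ ∑ i, max ((∑ t, y t) i - c) 0 :=
        Finset.sum_le_univ_sum_of_nonneg fun i => le_max_right _ _

/-- `OPT(E)`: the majorization-minimal feasible load vector of `E`. -/
def opt {n m : ℕ} (E : RequestSeq n m) : Fin n → ℝ := Classical.choose (exists_opt E)

/-! ### Randomized policies against adaptive adversaries -/

/-- A history of `t` rounds: the online nodes which arrived and the allocations chosen. -/
abbrev History (n t : ℕ) := Fin t → Request n × (Fin n → ℝ)

/-- A randomized allocation policy: for every history and every arriving online node, a
probability distribution, depending measurably on them, on the feasible allocations. -/
structure Policy (n : ℕ) where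
  kernel : (t : ℕ) → Kernel (History n t × Request n) (Fin n → ℝ)
  isMarkov : ∀ t, IsMarkovKernel (kernel t)
  feasible : ∀ (t : ℕ) (h : History n t) (r : Request n),
    ∀ᵐ x ∂(kernel t (h, r)), x ∈ r.feasible

/-- An adaptive request sequence with `m` online nodes: a (measurable) choice of the next
online node from the history of requests and allocations. -/
structure AdaptiveSeq (n m : ℕ) where
  next : (t : Fin m) → History n t → Request n
  measurable_next : ∀ t, Measurable (next t)

/-- The static request sequence of a complete play. -/
def History.requests {n m : ℕ} (h : History n m) : RequestSeq n m := fun t => (h t).1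

/-- The load vector of a complete play. -/
def History.load {n m : ℕ} (h : History n m) : Fin n → ℝ := ∑ t, (h t).2

/-- `h` is a possible play against `E`: the online nodes are those which `E` chooses, and the
allocations are feasible. -/
def AdaptiveSeq.IsPlay {n m : ℕ} (E : AdaptiveSeq n m) (h : History n m) : Prop :=
  ∀ t : Fin m, (h t).1 = E.next t (fun s => h (Fin.castLE t.isLt.le s)) ∧
    (h t).2 ∈ (h t).1.feasible

/-- Membership of an adaptive request sequence in `𝓔_{n,m,q}`: the total quantity is `q` on
every possible play. -/
def AdaptiveSeq.HasTotal {n m : ℕ} (E : AdaptiveSeq n m) (q : ℝ) : Prop :=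
  ∀ h : History n m, E.IsPlay h → h.requests.total = q

/-- The law of the first `t` rounds when policy `A` plays against `E`. -/
def playLaw {n m : ℕ} (A : Policy n) (E : AdaptiveSeq n m) :
    (t : ℕ) → t ≤ m → Measure (History n t)
  | 0, _ => Measure.dirac fun i => i.elim0
  | t + 1, ht =>
    (playLaw A E t (Nat.le_of_succ_le ht) ⊗ₘ
        (A.kernel t).comap (fun h => (h, E.next ⟨t, ht⟩ h))
          (measurable_id.prodMk (E.measurable_next ⟨t, ht⟩))).map
      fun p => (Fin.snoc p.1 (E.next ⟨t, ht⟩ p.1, p.2) : History n (t + 1))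

theorem isProbabilityMeasure_playLaw {n m : ℕ} (A : Policy n) (E : AdaptiveSeq n m) (t : ℕ)
    (ht : t ≤ m) : IsProbabilityMeasure (playLaw A E t ht) := by
  induction t with
  | zero => exact inferInstanceAs (IsProbabilityMeasure (Measure.dirac _))
  | succ t ih =>
    have := ih (Nat.le_of_succ_le ht)
    have := A.isMarkov t
    refine Measure.isProbabilityMeasure_map (Measurable.aemeasurable ?_)
    refine measurable_pi_iff.2 fun i => ?_
    refine Fin.lastCases ?_ (fun j => ?_) i
    · simp only [Fin.snoc_last]
      exact ((E.measurable_next ⟨t, ht⟩).comp measurable_fst).prodMk measurable_snd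
    · simp only [Fin.snoc_castSucc]
      exact (measurable_pi_apply j).comp measurable_fst

end

end OnlineAllocation

namespace OnlineAllocation

noncomputable section

/-! ### Majorization through sums over sets -/

/-! Cut the water-filling load `w` of `E` into horizontal slices at heights `0 = θ 0 < … < θ m = max
w` which include all loads. Slice `r` is a request for the nodes that reach `θ (r + 1)`, with
quantity the area of the slice; these node sets are nested. The adversary keeps the sizes and
quantities of the slices, but at each round takes as neighbourhood the currently most loaded nodes
of the previous one.

Against this adversary, serving every round evenly yields `w` up to relabelling, and no allocation
is more balanced: shrinking to the most loaded nodes retains at least the average load. An induction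
over rounds (`exists_sum_ge_of_isTop`) bounds from below the load on a suitable set of each size,
and this meets the bound from above for `w` (`sum_le_sum_min_card`).

For the optimum, a round of `E` whose water-filling reaches slice `r` has all its neighbours in that
slice, because their final loads are at least the water level. So any feasible load of `E` can be
regrouped as a feasible load of the slices (`exists_slice_allocation`). The adversary's
neighbourhoods are the slices up to one permutation (`exists_perm_of_card_eq`), which majorization
ignores. Both comparisons hold on every feasible play, and almost every play is feasible
(`ae_isPlay`). -/

theorem sum_le_sum_sortedDesc {n : ℕ} (x : Fin n → ℝ) (j : Fin n) (K : Finset (Fin n))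
    (hK : K.card = j + 1) : ∑ i ∈ K, x i ≤ ∑ i ∈ Finset.Iic j, sortedDesc x i := by
  -- With the threshold at the last sorted entry counted, the first `j + 1` sorted entries carry the
  -- whole positive excess; equal cardinalities then cancel the multiples of `c`.
  set c := sortedDesc x j
  have h1 : ∑ i ∈ K, (x i - c) ≤ ∑ i, max (x i - c) 0 :=
    (Finset.sum_le_sum fun i _ => le_max_left _ _).trans
      (Finset.sum_le_univ_sum_of_nonneg fun i => le_max_right _ _)
  have h2 : ∑ i, max (x i - c) 0 = ∑ i ∈ Finset.Iic j, (sortedDesc x i - c) := by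
    rw [← sum_sortedDesc x fun v => max (v - c) 0]
    rw [← Finset.sum_subset (Finset.subset_univ (Finset.Iic j))]
    · refine Finset.sum_congr rfl fun i hi => max_eq_left ?_
      exact sub_nonneg.2 (sortedDesc_antitone x (Finset.mem_Iic.1 hi))
    · intro i _ hi
      refine max_eq_right (sub_nonpos.2 (sortedDesc_antitone x ?_))
      exact (not_le.1 fun h => hi (Finset.mem_Iic.2 h)).le
  have h3 := h1.trans h2.le
  rw [Finset.sum_sub_distrib, Finset.sum_sub_distrib, Finset.sum_const, Finset.sum_const, hK,
    Fin.card_Iic] at h3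
  linarith

theorem exists_sum_eq_sum_sortedDesc {n : ℕ} (x : Fin n → ℝ) (j : Fin n) :
    ∃ K : Finset (Fin n), K.card = j + 1 ∧
      ∑ i ∈ K, x i = ∑ i ∈ Finset.Iic j, sortedDesc x i := by
  refine ⟨(Finset.Iic j).map (Fin.revPerm.trans (Tuple.sort x)).toEmbedding, ?_, ?_⟩
  · simp
  · rw [Finset.sum_map]; rfl

/-- This form avoids sorting: the adversary argument bounds loads on explicit sets of nodes. -/
theorem majorizes_iff_sets {n : ℕ} (x y : Fin n → ℝ) :
    Majorizes x y ↔ ∑ i, x i = ∑ i, y i ∧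
      ∀ K : Finset (Fin n), ∃ K' : Finset (Fin n), K'.card = K.card ∧
        ∑ i ∈ K, y i ≤ ∑ i ∈ K', x i := by
  refine and_congr_right fun _ => ⟨fun h K => ?_, fun h j => ?_⟩
  · rcases Nat.eq_zero_or_pos K.card with h0 | h0
    · exact ⟨∅, by simp [h0], by simp [Finset.card_eq_zero.1 h0]⟩
    · have hn : K.card ≤ n := by simpa using K.card_le_univ
      let j : Fin n := ⟨K.card - 1, by omega⟩
      have hj : K.card = j + 1 := by simp only [j]; omega
      obtain ⟨K', hc, hs⟩ := exists_sum_eq_sum_sortedDesc x j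
      exact ⟨K', by rw [hc, hj], (sum_le_sum_sortedDesc y j K hj).trans ((h j).trans hs.ge)⟩
  · obtain ⟨K, hc, hs⟩ := exists_sum_eq_sum_sortedDesc y j
    obtain ⟨K', hc', hs'⟩ := h K
    rw [← hs]
    exact hs'.trans (sum_le_sum_sortedDesc x j K' (by rw [hc', hc]))

theorem Majorizes.of_comp_perm {n : ℕ} {x y : Fin n → ℝ} (σ : Equiv.Perm (Fin n))
    (h : Majorizes (x ∘ σ) y) : Majorizes x y := by
  rw [majorizes_iff_sets] at h ⊢
  refine ⟨by rw [← h.1]; exact (Equiv.sum_comp σ x).symm, fun K => ?_⟩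
  obtain ⟨K', hc, hs⟩ := h.2 K
  exact ⟨K'.map σ.toEmbedding, by simp [hc], by simpa [Finset.sum_map] using hs⟩

/-! ### Subsets of largest values -/

/-- `T` consists of `k` elements of `S` on which `v` takes its largest values within `S`. -/
structure IsTop {n : ℕ} (v : Fin n → ℝ) (S : Finset (Fin n)) (k : ℕ) (T : Finset (Fin n)) :
    Prop where
  subset : T ⊆ S
  card_eq : T.card = k
  le : ∀ i ∈ T, ∀ j ∈ S, j ∉ T → v j ≤ v i

theorem exists_isTop {n : ℕ} (v : Fin n → ℝ) (S : Finset (Fin n)) (k : ℕ) (hk : k ≤ S.card) :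
    ∃ T, IsTop v S k T := by
  induction k with
  | zero => exact ⟨∅, by simp, by simp, by simp⟩
  | succ k ih =>
    obtain ⟨T, hT⟩ := ih (by omega)
    have hne : (S \ T).Nonempty := by
      rw [← Finset.card_pos, Finset.card_sdiff_of_subset hT.subset, hT.card_eq]; omega
    obtain ⟨a, ha, hmax⟩ := Finset.exists_max_image (S \ T) v hne
    rw [Finset.mem_sdiff] at ha
    refine ⟨insert a T, ?_, ?_, ?_⟩
    · exact Finset.insert_subset ha.1 hT.subset
    · rw [Finset.card_insert_of_notMem ha.2, hT.card_eq]
    · intro i hi j hj hjT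
      rw [Finset.mem_insert, not_or] at hjT
      rcases Finset.mem_insert.1 hi with rfl | hi
      · exact hmax j (Finset.mem_sdiff.2 ⟨hj, hjT.2⟩)
      · exact hT.le i hi j hj hjT.2

/-- The average over `T` is at least the average over `S`: sum `v i - v j ≥ 0` over `T × (S \ T)`.
-/
theorem IsTop.card_mul_sum_le {n : ℕ} {v : Fin n → ℝ} {S : Finset (Fin n)} {k : ℕ}
    {T : Finset (Fin n)} (h : IsTop v S k T) :
    (k : ℝ) * ∑ i ∈ S, v i ≤ S.card * ∑ i ∈ T, v i := by
  have h0 : 0 ≤ ∑ i ∈ T, ∑ j ∈ S \ T, (v i - v j) :=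
    Finset.sum_nonneg fun i hi => Finset.sum_nonneg fun j hj => by
      rw [Finset.mem_sdiff] at hj
      exact sub_nonneg.2 (h.le i hi j hj.1 hj.2)
  simp only [Finset.sum_sub_distrib, Finset.sum_const, nsmul_eq_mul, ← Finset.mul_sum] at h0
  have h1 := Finset.sum_sdiff (f := v) h.subset
  have h2 : ((S \ T).card : ℝ) + T.card = S.card := by
    exact_mod_cast Finset.card_sdiff_add_card_eq_card h.subset
  rw [h.card_eq] at h0 h2
  rw [← h1, ← h2]
  linarith

theorem IsTop.exists_between {n : ℕ} {v : Fin n → ℝ} {S : Finset (Fin n)} {a k : ℕ}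
    {T : Finset (Fin n)} (h : IsTop v S a T) (hak : a ≤ k) (hk : k ≤ S.card) :
    ∃ K, T ⊆ K ∧ IsTop v S k K := by
  obtain ⟨R, hR⟩ := exists_isTop v (S \ T) (k - a)
    (by rw [Finset.card_sdiff_of_subset h.subset, h.card_eq]; omega)
  have hd : Disjoint T R := Finset.disjoint_of_subset_right hR.subset Finset.disjoint_sdiff
  refine ⟨T ∪ R, Finset.subset_union_left, ?_, ?_, ?_⟩
  · exact Finset.union_subset h.subset (hR.subset.trans Finset.sdiff_subset)
  · rw [Finset.card_union_of_disjoint hd, h.card_eq, hR.card_eq]; omega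
  · intro i hi j hj hjK
    rw [Finset.mem_union, not_or] at hjK
    rcases Finset.mem_union.1 hi with hi | hi
    · exact h.le i hi j hj hjK.1
    · exact hR.le i hi j (Finset.mem_sdiff.2 ⟨hj, hjK.1⟩) hjK.2

/-! ### Nested families of sets -/

/-- A nested family is determined by the depth `f M i` of each point, the number of members
containing it. Equal sizes force equally many points of each depth, so matching the fibres of the
depth gives one permutation for all `t`. -/
theorem exists_perm_of_card_eq {n : ℕ} (N S : ℕ → Finset (Fin n)) (hN : Antitone N)
    (hS : Antitone S) (m : ℕ) (h : ∀ t < m, (N t).card = (S t).card) :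
    ∃ σ : Equiv.Perm (Fin n), ∀ t < m, ∀ i, σ i ∈ S t ↔ i ∈ N t := by
  let f : (ℕ → Finset (Fin n)) → Fin n → ℕ := fun M i =>
    ((Finset.range m).filter fun t => i ∈ M t).card
  have hf : ∀ M, Antitone M → ∀ t < m, ∀ i, i ∈ M t ↔ t < f M i := by
    intro M hM t ht i
    constructor
    · intro hi
      have : Finset.range (t + 1) ⊆ (Finset.range m).filter fun t => i ∈ M t := fun r hr => by
        rw [Finset.mem_range] at hr
        exact Finset.mem_filter.2 ⟨Finset.mem_range.2 (by omega), hM (by omega : r ≤ t) hi⟩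
      simpa [f] using Finset.card_le_card this
    · intro hlt
      by_contra hi
      have : (Finset.range m).filter (fun t => i ∈ M t) ⊆ Finset.range t := fun r hr => by
        rw [Finset.mem_filter] at hr
        rw [Finset.mem_range]
        by_contra! hle
        exact hi (hM hle hr.2)
      have := Finset.card_le_card this
      rw [Finset.card_range] at this
      exact absurd hlt (not_lt.2 this)
  have hle : ∀ M i, f M i ≤ m := fun M i =>
    (Finset.card_filter_le _ _).trans (Finset.card_range m).le
  have hge : ∀ v, (Finset.univ.filter fun i => v ≤ f N i).card =
      (Finset.univ.filter fun i => v ≤ f S i).card := by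
    intro v
    rcases v with _ | v
    · simp
    · rcases lt_or_ge v m with hv | hv
      · have h1 : ∀ M, Antitone M → (Finset.univ.filter fun i => v + 1 ≤ f M i) = M v := by
          intro M hM; ext i; simp [hf M hM v hv]
        rw [h1 N hN, h1 S hS, h v hv]
      · have h1 : ∀ M, (Finset.univ.filter fun i => v + 1 ≤ f M i) = ∅ := by
          intro M; ext i; have := hle M i; simp; omega
        rw [h1 N, h1 S]
  have hsplit : ∀ M v, (Finset.univ.filter fun i => v ≤ f M i).card =
      (Finset.univ.filter fun i => f M i = v).card +
        (Finset.univ.filter fun i => v + 1 ≤ f M i).card := by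
    intro M v
    rw [← Finset.card_union_of_disjoint]
    · congr 1; ext i; simp; omega
    · rw [Finset.disjoint_left]; intro i; simp; omega
  have heq : ∀ v, Fintype.card {i // f N i = v} = Fintype.card {i // f S i = v} := by
    intro v
    rw [Fintype.card_subtype, Fintype.card_subtype]
    have h1 := hsplit N v
    have h2 := hsplit S v
    rw [hge v, hge (v + 1)] at h1
    omega
  refine ⟨Equiv.ofFiberEquiv fun v => Fintype.equivOfCardEq (heq v), fun t ht i => ?_⟩
  rw [hf S hS t ht, hf N hN t ht]
  have := Equiv.ofFiberEquiv_map (fun v => Fintype.equivOfCardEq (heq v)) i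
  rw [this]

/-! ### Water-filling runs -/

theorem waterFillingStep_mem {n : ℕ} (r : Request n) (l : Fin n → ℝ) :
    waterFillingStep r l ∈ r.feasible :=
  (Classical.choose_spec (exists_waterFillingStep r l)).1

/-- Water-filling only serves nodes of least resulting load. -/
theorem waterFillingStep_level {n : ℕ} (r : Request n) (l : Fin n → ℝ) (i j : Fin n)
    (hi : 0 < waterFillingStep r l i) (hj : j ∈ r.nbrs) :
    l i + waterFillingStep r l i ≤ l j + waterFillingStep r l j := by
  obtain ⟨hx, hmax⟩ := Classical.choose_spec (exists_waterFillingStep r l)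
  change waterFillingStep r l ∈ r.feasible at hx
  change ∀ y ∈ r.feasible, r.minLoad l y ≤ r.minLoad l (waterFillingStep r l) at hmax
  set x := waterFillingStep r l
  by_contra! hlt
  have hiN : i ∈ r.nbrs := by
    by_contra h
    rw [hx.2.1 i h] at hi
    exact lt_irrefl _ hi
  have hk : (0 : ℝ) < r.nbrs.card := by exact_mod_cast r.nonempty.card_pos
  -- Take `e` from `i` and spread it evenly over all neighbours. As `e` is less than the gap, `i`
  -- stays above `j`'s old load, so every neighbour ends strictly above the old minimum.
  obtain ⟨e, he0, he1, he2⟩ : ∃ e : ℝ, 0 < e ∧ e ≤ x i ∧ e < l i + x i - (l j + x j) :=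
    ⟨min (x i) ((l i + x i - (l j + x j)) / 2), lt_min hi (by linarith), min_le_left _ _,
      (min_le_right _ _).trans_lt (by linarith)⟩
  set z : Fin n → ℝ := fun k =>
    x k + (if k ∈ r.nbrs then e / r.nbrs.card else 0) - if k = i then e else 0
  have hd : 0 < e / r.nbrs.card := by positivity
  have hz : z ∈ r.feasible := by
    refine ⟨fun k => ?_, fun k hkN => ?_, ?_⟩
    · have := hx.1 k
      rcases eq_or_ne k i with rfl | h
      · simp only [z, hiN, if_true]; linarith
      · simp only [z, h, if_false, sub_zero]; split_ifs <;> linarith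
    · have : k ≠ i := by rintro rfl; exact hkN hiN
      simp [z, hkN, hx.2.1 k hkN, this]
    · have : ∑ k, (if k ∈ r.nbrs then e / r.nbrs.card else 0) = e := by
        rw [Finset.sum_ite_mem, Finset.univ_inter, Finset.sum_const, nsmul_eq_mul]
        field_simp
      simp only [z]
      rw [Finset.sum_sub_distrib, Finset.sum_add_distrib, this, hx.2.2]
      simp
  refine absurd (hmax z hz) (not_le.2 ((Finset.lt_inf'_iff _).2 fun k hkN => ?_))
  have h1 : r.minLoad l x ≤ x k + l k := Finset.inf'_le (fun i => x i + l i) hkN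
  have h2 : r.minLoad l x ≤ x j + l j := Finset.inf'_le (fun i => x i + l i) hj
  rcases eq_or_ne k i with rfl | h
  · simp only [z, hkN, if_true]; linarith
  · simp only [z, hkN, h, if_true, if_false]; linarith

/-- `wfLoad E t`: the water-filling load after the first `t` online nodes. -/
def wfLoad {n m : ℕ} (E : RequestSeq n m) : ℕ → Fin n → ℝ
  | 0 => 0
  | t + 1 => if h : t < m then wfLoad E t + waterFillingStep (E ⟨t, h⟩) (wfLoad E t)
      else wfLoad E t

theorem wfLoad_succ {n m : ℕ} (E : RequestSeq n m) (t : Fin m) :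
    wfLoad E (t + 1) = wfLoad E t + waterFillingStep (E t) (wfLoad E t) := by
  simp [wfLoad]

theorem wfLoad_eq_foldl {n m : ℕ} (E : RequestSeq n m) (t : ℕ) (ht : t ≤ m) :
    wfLoad E t =
      Fin.foldl t (fun l i => l + waterFillingStep (E (Fin.castLE ht i)) l) 0 := by
  induction t with
  | zero => simp [wfLoad]
  | succ t ih =>
    rw [Fin.foldl_succ_last, wfLoad, dif_pos (show t < m from ht), ih (by omega)]
    rfl

theorem wfLoad_eq_waterFilling {n m : ℕ} (E : RequestSeq n m) : wfLoad E m = waterFilling E :=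
  wfLoad_eq_foldl E m le_rfl

theorem wfLoad_monotone {n m : ℕ} (E : RequestSeq n m) (i : Fin n) :
    Monotone fun t => wfLoad E t i := by
  refine monotone_nat_of_le_succ fun t => ?_
  rw [wfLoad]
  split_ifs with h
  · simpa using (waterFillingStep_mem (E ⟨t, h⟩) (wfLoad E t)).1 i
  · exact le_rfl

theorem wfLoad_nonneg {n m : ℕ} (E : RequestSeq n m) (t : ℕ) (i : Fin n) : 0 ≤ wfLoad E t i := by
  simpa [wfLoad] using wfLoad_monotone E i (Nat.zero_le t)

/-- The water level reached by the `t`-th online node. -/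
def wfLevel {n m : ℕ} (E : RequestSeq n m) (t : Fin m) : ℝ :=
  (E t).minLoad (wfLoad E t) (waterFillingStep (E t) (wfLoad E t))

theorem wfLevel_le {n m : ℕ} (E : RequestSeq n m) (t : Fin m) {j : Fin n}
    (hj : j ∈ (E t).nbrs) : wfLevel E t ≤ waterFilling E j := by
  rw [← wfLoad_eq_waterFilling]
  refine le_trans ?_ (wfLoad_monotone E j (Nat.succ_le_of_lt t.isLt))
  simp only [Nat.succ_eq_add_one, wfLoad_succ, Pi.add_apply]
  rw [add_comm]
  exact Finset.inf'_le
    (fun i => waterFillingStep (E t) (wfLoad E t) i + wfLoad E t i) hj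

theorem wfLoad_succ_eq_wfLevel {n m : ℕ} (E : RequestSeq n m) (t : Fin m) (i : Fin n)
    (hi : wfLoad E t i < wfLoad E (t + 1) i) : wfLoad E (t + 1) i = wfLevel E t := by
  rw [wfLoad_succ] at hi ⊢
  simp only [Pi.add_apply, lt_add_iff_pos_right] at hi ⊢
  have hiN : i ∈ (E t).nbrs := by
    by_contra h
    rw [(waterFillingStep_mem _ _).2.1 i h] at hi
    exact lt_irrefl _ hi
  refine le_antisymm (Finset.le_inf' (E t).nonempty _ fun j hj => ?_) ?_
  · rw [add_comm (waterFillingStep _ _ j)]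
    exact waterFillingStep_level _ _ i j hi hj
  · rw [add_comm]
    exact Finset.inf'_le
      (fun i => waterFillingStep (E t) (wfLoad E t) i + wfLoad E t i) hiN

/-- A positive final load is the level of the last round that raised it. Hence there are at most `m`
distinct positive loads, and `m` slices suffice. -/
theorem waterFilling_eq_zero_or_wfLevel {n m : ℕ} (E : RequestSeq n m) (i : Fin n) :
    waterFilling E i = 0 ∨ ∃ t, waterFilling E i = wfLevel E t := by
  rw [← wfLoad_eq_waterFilling]
  suffices h : ∀ t ≤ m, wfLoad E t i = 0 ∨ ∃ s, wfLoad E t i = wfLevel E s from h m le_rfl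
  intro t
  induction t with
  | zero => exact fun _ => Or.inl rfl
  | succ t ih =>
    intro ht
    rcases (wfLoad_monotone E i t.le_succ).eq_or_lt with h | h
    · simp only at h
      rw [Nat.succ_eq_add_one] at h
      rw [← h]; exact ih (by omega)
    · exact Or.inr ⟨⟨t, ht⟩, wfLoad_succ_eq_wfLevel E ⟨t, ht⟩ i h⟩

theorem sum_wfLoad_succ_sub {n m : ℕ} (E : RequestSeq n m) (t : Fin m) :
    ∑ i, (wfLoad E (t + 1) i - wfLoad E t i) = (E t).quantity := by
  simp [wfLoad_succ, (waterFillingStep_mem (E t) (wfLoad E t)).2.2]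

theorem sum_waterFilling {n m : ℕ} (E : RequestSeq n m) : ∑ i, waterFilling E i = E.total := by
  rw [RequestSeq.total, ← wfLoad_eq_waterFilling]
  simp only [← sum_wfLoad_succ_sub]
  rw [Fin.sum_univ_eq_sum_range fun t => ∑ i, (wfLoad E (t + 1) i - wfLoad E t i),
    Finset.sum_comm]
  refine Finset.sum_congr rfl fun i _ => ?_
  rw [Finset.sum_range_sub fun t => wfLoad E t i]
  simp [wfLoad]

/-! ### Slicing water-filling at a ladder of heights -/

/-- The set `F` is padded to exactly `m` points of `(0, M]` and enumerated increasingly, since the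
adversary needs exactly `m` rounds of positive quantity. -/
theorem exists_ladder (F : Finset ℝ) (M : ℝ) (m : ℕ) (hF : ∀ x ∈ F, 0 < x ∧ x ≤ M) (hM : M ∈ F)
    (hc : F.card ≤ m) : ∃ θ : ℕ → ℝ, StrictMono θ ∧ θ 0 = 0 ∧ θ m = M ∧
      ∀ x ∈ F, ∃ r ≤ m, x = θ r := by
  have hM0 : 0 < M := (hF M hM).1
  obtain ⟨G', hFG', hGs, hGc⟩ := (Set.Ioc_infinite hM0).exists_superset_ncard_eq
    (s := (F : Set ℝ)) (fun x hx => hF x hx) F.finite_toSet (k := m) (by simpa using hc)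
  have hFc : 0 < F.card := Finset.card_pos.2 ⟨M, hM⟩
  have hfin : G'.Finite := Set.finite_of_ncard_pos (by omega)
  lift G' to Finset ℝ using hfin
  rename' G' => G
  rw [Set.ncard_coe_finset] at hGc
  let e := G.orderEmbOfFin hGc
  have he : ∀ r, 0 < e r ∧ e r ≤ M := fun r => hGs (G.orderEmbOfFin_mem hGc r)
  -- The values past index `m` only keep `θ` strictly increasing.
  let θ : ℕ → ℝ := fun r => Nat.casesOn r 0 fun r =>
    if h : r < m then e ⟨r, h⟩ else M + (r + 1)
  have hθs : ∀ r (h : r < m), θ (r + 1) = e ⟨r, h⟩ := fun r h => dif_pos h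
  have hθl : ∀ r, ¬ r < m → θ (r + 1) = M + (r + 1) := fun r h => dif_neg h
  have hmono : StrictMono θ := by
    refine strictMono_nat_of_lt_succ fun r => ?_
    rcases r with _ | r
    · rw [hθs 0 (by omega)]
      exact (he _).1
    · by_cases h1 : r + 1 < m
      · rw [hθs r (by omega), hθs (r + 1) h1]
        exact e.strictMono (Fin.mk_lt_mk.2 r.lt_succ_self)
      · rw [hθl (r + 1) h1]
        push_cast
        by_cases h2 : r < m
        · rw [hθs r h2]
          have : (0 : ℝ) ≤ r := r.cast_nonneg
          linarith [(he ⟨r, h2⟩).2]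
        · rw [hθl r h2]; linarith
  have hex : ∀ x ∈ F, ∃ r ≤ m, x = θ r := by
    intro x hx
    have : x ∈ Set.range e := by
      rw [Finset.range_orderEmbOfFin]; exact hFG' hx
    obtain ⟨r, hr⟩ := this
    exact ⟨r + 1, r.isLt, by rw [hθs r r.isLt, ← hr]⟩
  refine ⟨θ, hmono, rfl, le_antisymm ?_ ?_, hex⟩
  · obtain ⟨k, rfl⟩ : ∃ k, m = k + 1 := ⟨m - 1, by omega⟩
    rw [hθs k k.lt_succ_self]
    exact (he _).2
  · obtain ⟨r, hr, h⟩ := hex M hM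
    rw [h]
    exact hmono.monotone hr

/-- A ladder of `m` positive heights among which are all positive water-filling loads. -/
theorem exists_ladder_waterFilling {n m : ℕ} (E : RequestSeq n m) (hE : 0 < E.total) :
    ∃ θ : ℕ → ℝ, StrictMono θ ∧ θ 0 = 0 ∧ (∀ i, ∃ r ≤ m, waterFilling E i = θ r) ∧
      ∃ i, waterFilling E i = θ m := by
  set w := waterFilling E with hwdef
  have hw0 : ∀ i, 0 ≤ w i := fun i => by
    rw [hwdef, ← wfLoad_eq_waterFilling]; exact wfLoad_nonneg E m i
  obtain ⟨i₀, -, hi₀⟩ : ∃ i ∈ Finset.univ, 0 < w i := by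
    by_contra! h
    have := Finset.sum_nonpos h
    rw [sum_waterFilling] at this
    exact absurd hE (not_lt.2 this)
  obtain ⟨i₁, -, hi₁⟩ := Finset.exists_max_image Finset.univ w ⟨i₀, Finset.mem_univ _⟩
  let F : Finset ℝ := (Finset.univ.image w).filter fun x => 0 < x
  have hmem : ∀ i, 0 < w i → w i ∈ F := fun i hi =>
    Finset.mem_filter.2 ⟨Finset.mem_image_of_mem w (Finset.mem_univ i), hi⟩
  have hF : ∀ x ∈ F, 0 < x ∧ x ≤ w i₁ := by
    intro x hx
    obtain ⟨hx, hx0⟩ := Finset.mem_filter.1 hx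
    obtain ⟨i, -, rfl⟩ := Finset.mem_image.1 hx
    exact ⟨hx0, hi₁ i (Finset.mem_univ i)⟩
  have hc : F.card ≤ m := by
    have : F ⊆ Finset.univ.image (wfLevel E) := by
      intro x hx
      obtain ⟨hx, hx0⟩ := Finset.mem_filter.1 hx
      obtain ⟨i, -, rfl⟩ := Finset.mem_image.1 hx
      rcases waterFilling_eq_zero_or_wfLevel E i with h | ⟨t, h⟩
      · exact absurd h hx0.ne'
      · exact Finset.mem_image.2 ⟨t, Finset.mem_univ t, h.symm⟩
    simpa using (Finset.card_le_card this).trans Finset.card_image_le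
  obtain ⟨θ, hθ, h0, hm, hex⟩ := exists_ladder F (w i₁) m hF
    (hmem i₁ (hi₀.trans_le (hi₁ i₀ (Finset.mem_univ _)))) hc
  refine ⟨θ, hθ, h0, fun i => ?_, i₁, hm.symm⟩
  rcases (hw0 i).eq_or_lt with h | h
  · exact ⟨0, m.zero_le, by rw [h0, ← h]⟩
  · exact hex _ (hmem i h)

/-- The length of the part of `[0, z]` between the heights `θ r` and `θ (r + 1)`. -/
def slice (θ : ℕ → ℝ) (r : ℕ) (z : ℝ) : ℝ := min z (θ (r + 1)) - min z (θ r)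

theorem slice_monotone {θ : ℕ → ℝ} (hθ : StrictMono θ) (r : ℕ) : Monotone (slice θ r) := by
  intro a b hab
  have := hθ r.lt_succ_self
  rw [Nat.succ_eq_add_one] at this
  unfold slice
  rcases min_cases a (θ (r + 1)) with h1 | h1 <;> rcases min_cases a (θ r) with h2 | h2 <;>
  rcases min_cases b (θ (r + 1)) with h3 | h3 <;> rcases min_cases b (θ r) with h4 | h4 <;>
  linarith

theorem slice_eq_zero {θ : ℕ → ℝ} (hθ : StrictMono θ) {r : ℕ} {z : ℝ} (hz : z ≤ θ r) :
    slice θ r z = 0 := by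
  rw [slice, min_eq_left hz, min_eq_left (hz.trans (hθ r.lt_succ_self).le), sub_self]

theorem sum_slice {θ : ℕ → ℝ} (h0 : θ 0 = 0) {m : ℕ} {z : ℝ} (hz : 0 ≤ z) (hzm : z ≤ θ m) :
    ∑ r ∈ Finset.range m, slice θ r z = z := by
  unfold slice
  rw [Finset.sum_range_sub fun r => min z (θ r), h0, min_eq_left hzm, min_eq_right hz, sub_zero]

/-- The nodes on which the load `w` exceeds the `r`-th slice. -/
def upper {n : ℕ} (θ : ℕ → ℝ) (w : Fin n → ℝ) (r : ℕ) : Finset (Fin n) :=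
  Finset.univ.filter fun j => θ (r + 1) ≤ w j

theorem upper_antitone {n : ℕ} {θ : ℕ → ℝ} (hθ : StrictMono θ) (w : Fin n → ℝ) :
    Antitone (upper θ w) := by
  intro r s hrs j hj
  simp only [upper, Finset.mem_filter, Finset.mem_univ, true_and] at hj ⊢
  exact (hθ.monotone (Nat.succ_le_succ hrs)).trans hj

/-- Loads occur only at ladder heights, so each node fills a slice completely or not at all. -/
theorem le_of_notMem_upper {n m : ℕ} {θ : ℕ → ℝ} (hθ : StrictMono θ) {w : Fin n → ℝ}
    (hw : ∀ i, ∃ r ≤ m, w i = θ r) {r : ℕ} {j : Fin n} (hj : j ∉ upper θ w r) : w j ≤ θ r := by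
  obtain ⟨a, -, ha⟩ := hw j
  simp only [upper, Finset.mem_filter, Finset.mem_univ, true_and, ha, not_le, hθ.lt_iff_lt] at hj
  rw [ha, hθ.le_iff_le]
  omega

theorem slice_eq_ite {n m : ℕ} {θ : ℕ → ℝ} (hθ : StrictMono θ) {w : Fin n → ℝ}
    (hw : ∀ i, ∃ r ≤ m, w i = θ r) (r : ℕ) (j : Fin n) :
    slice θ r (w j) = if j ∈ upper θ w r then θ (r + 1) - θ r else 0 := by
  split_ifs with h
  · simp only [upper, Finset.mem_filter, Finset.mem_univ, true_and] at h
    rw [slice, min_eq_right h, min_eq_right ((hθ r.lt_succ_self).le.trans h)]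
  · exact slice_eq_zero hθ (le_of_notMem_upper hθ hw h)

theorem sum_slice_eq {n m : ℕ} {θ : ℕ → ℝ} (hθ : StrictMono θ) {w : Fin n → ℝ}
    (hw : ∀ i, ∃ r ≤ m, w i = θ r) (r : ℕ) (K : Finset (Fin n)) :
    ∑ j ∈ K, slice θ r (w j) = (K ∩ upper θ w r).card * (θ (r + 1) - θ r) := by
  simp only [slice_eq_ite hθ hw]
  rw [Finset.sum_ite_mem, Finset.sum_const, nsmul_eq_mul]

theorem ladder_bounds {n m : ℕ} {θ : ℕ → ℝ} (hθ : StrictMono θ) (h0 : θ 0 = 0)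
    {w : Fin n → ℝ} (hw : ∀ i, ∃ r ≤ m, w i = θ r) (j : Fin n) : 0 ≤ w j ∧ w j ≤ θ m := by
  obtain ⟨a, ha, h⟩ := hw j
  exact ⟨by rw [h, ← h0]; exact hθ.monotone a.zero_le, by rw [h]; exact hθ.monotone ha⟩

/-- The load on a set of nodes, summed slice by slice. -/
theorem sum_eq_sum_card_inter {n m : ℕ} {θ : ℕ → ℝ} (hθ : StrictMono θ) (h0 : θ 0 = 0)
    {w : Fin n → ℝ} (hw : ∀ i, ∃ r ≤ m, w i = θ r) (K : Finset (Fin n)) :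
    ∑ j ∈ K, w j =
      ∑ r ∈ Finset.range m, (K ∩ upper θ w r).card * (θ (r + 1) - θ r) := by
  have hbd := ladder_bounds hθ h0 hw
  simp only [← sum_slice_eq hθ hw]
  rw [Finset.sum_comm]
  exact Finset.sum_congr rfl fun j _ => (sum_slice h0 (hbd j).1 (hbd j).2).symm

/-- The right side depends only on the slice sizes and `K.card`; it is the quantity that
`exists_sum_ge_of_isTop` gives as a lower bound. -/
theorem sum_le_sum_min_card {n m : ℕ} {θ : ℕ → ℝ} (hθ : StrictMono θ) (h0 : θ 0 = 0)
    {w : Fin n → ℝ} (hw : ∀ i, ∃ r ≤ m, w i = θ r) (K : Finset (Fin n)) :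
    ∑ j ∈ K, w j ≤ ∑ r ∈ Finset.range m,
      (θ (r + 1) - θ r) * min (K.card : ℝ) ((upper θ w r).card : ℝ) := by
  rw [sum_eq_sum_card_inter hθ h0 hw]
  refine Finset.sum_le_sum fun r _ => ?_
  rw [mul_comm]
  refine mul_le_mul_of_nonneg_left (le_min ?_ ?_) (sub_nonneg.2 (hθ r.lt_succ_self).le)
  · exact_mod_cast Finset.card_le_card Finset.inter_subset_left
  · exact_mod_cast Finset.card_le_card Finset.inter_subset_right

/-- Every feasible load of `E` can be served by the slices of the water-filling load. -/
theorem exists_slice_allocation {n m : ℕ} (E : RequestSeq n m) {θ : ℕ → ℝ} (hθ : StrictMono θ)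
    (h0 : θ 0 = 0) (hw : ∀ i, ∃ r ≤ m, waterFilling E i = θ r) {l : Fin n → ℝ}
    (hl : l ∈ E.loads) : ∃ z : Fin m → Fin n → ℝ, l = ∑ r, z r ∧ ∀ r : Fin m,
      (∀ i, 0 ≤ z r i) ∧ (∀ i, i ∉ upper θ (waterFilling E) r → z r i = 0) ∧
        ∑ i, z r i = (upper θ (waterFilling E) r).card * (θ (r + 1) - θ r) := by
  obtain ⟨y, hy, rfl⟩ := hl
  set w := waterFilling E with hwdef
  have hbd : ∀ t ≤ m, ∀ j, wfLoad E t j ≤ θ m := fun t ht j => by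
    have := wfLoad_monotone E j ht
    simp only [wfLoad_eq_waterFilling] at this
    exact this.trans (ladder_bounds hθ h0 hw j).2
  -- The amount that water-filling pours into slice `r` during round `t`; it sets the proportions in
  -- which `y t` is split among the slices.
  set g : Fin m → ℕ → ℝ := fun t r =>
    ∑ i, (slice θ r (wfLoad E (t + 1) i) - slice θ r (wfLoad E t i)) with hg
  have hg0 : ∀ t r, 0 ≤ g t r := fun t r => Finset.sum_nonneg fun i _ =>
    sub_nonneg.2 (slice_monotone hθ r (wfLoad_monotone E i (Nat.le_succ t)))
  have hgsum : ∀ t, ∑ r : Fin m, g t r = (E t).quantity := by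
    intro t
    rw [Fin.sum_univ_eq_sum_range (g t), Finset.sum_comm, ← sum_wfLoad_succ_sub]
    refine Finset.sum_congr rfl fun i _ => ?_
    rw [Finset.sum_sub_distrib, sum_slice h0 (wfLoad_nonneg E _ i) (hbd _ t.isLt i),
      sum_slice h0 (wfLoad_nonneg E _ i) (hbd _ t.isLt.le i)]
  have hgtot : ∀ r, ∑ t, g t r = (upper θ w r).card * (θ (r + 1) - θ r) := by
    intro r
    rw [hg, Fin.sum_univ_eq_sum_range fun t =>
      ∑ i, (slice θ r (wfLoad E (t + 1) i) - slice θ r (wfLoad E t i)), Finset.sum_comm]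
    have : ∀ i, ∑ t ∈ Finset.range m,
        (slice θ r (wfLoad E (t + 1) i) - slice θ r (wfLoad E t i)) = slice θ r (w i) := by
      intro i
      rw [Finset.sum_range_sub fun t => slice θ r (wfLoad E t i), wfLoad_eq_waterFilling]
      rw [show slice θ r (wfLoad E 0 i) = 0 from
        slice_eq_zero hθ (h0.symm.le.trans (hθ.monotone r.zero_le)), sub_zero]
    simp only [this]
    rw [sum_slice_eq hθ hw, Finset.univ_inter]
  -- If a neighbour ends at or below `θ r`, so does the level of round `t`, and no node served in
  -- that round reaches slice `r`.
  have hgz : ∀ t r j, j ∈ (E t).nbrs → j ∉ upper θ w r → g t r = 0 := by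
    intro t r j hj hjr
    refine Finset.sum_eq_zero fun i _ => ?_
    rcases (wfLoad_monotone E i (Nat.le_succ t)).eq_or_lt with h | h
    · simp only [Nat.succ_eq_add_one] at h
      rw [h, sub_self]
    · have h1 : wfLoad E (t + 1) i ≤ θ r := by
        rw [wfLoad_succ_eq_wfLevel E t i h]
        exact (wfLevel_le E t hj).trans (le_of_notMem_upper hθ hw hjr)
      rw [slice_eq_zero hθ h1, slice_eq_zero hθ (h.le.trans h1), sub_self]
  refine ⟨fun r i => ∑ t, g t r / (E t).quantity * y t i, ?_, fun r => ⟨fun i => ?_, ?_, ?_⟩⟩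
  · funext i
    simp only [Finset.sum_apply]
    rw [Finset.sum_comm]
    refine Finset.sum_congr rfl fun t _ => ?_
    rw [← Finset.sum_mul, ← Finset.sum_div, hgsum, div_self (E t).pos.ne', one_mul]
  · exact Finset.sum_nonneg fun t _ =>
      mul_nonneg (div_nonneg (hg0 t r) (E t).pos.le) ((hy t).1 i)
  · intro i hi
    refine Finset.sum_eq_zero fun t _ => ?_
    by_cases h : i ∈ (E t).nbrs
    · rw [hgz t r i h hi, zero_div, zero_mul]
    · rw [(hy t).2.1 i h, mul_zero]
  · rw [Finset.sum_comm, ← hgtot]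
    refine Finset.sum_congr rfl fun t _ => ?_
    rw [← Finset.mul_sum, (hy t).2.2, div_mul_cancel₀ _ (E t).pos.ne']

/-! ### Shrinking to the most loaded nodes -/

/-- If each arriving node is compatible with the currently most loaded nodes among the previous
neighbours, every policy is at least as unbalanced as the even one. -/
theorem exists_sum_ge_of_isTop {n m : ℕ} (s : ℕ → ℕ) (d : ℕ → ℝ) (hs : Antitone s)
    (hs0 : s 0 ≤ n) (N : ℕ → Finset (Fin n)) (x : ℕ → Fin n → ℝ)
    (hN0 : (N 0).card = s 0)
    (hN : ∀ t, IsTop (∑ r ∈ Finset.range (t + 1), x r) (N t) (s (t + 1)) (N (t + 1)))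
    (hxN : ∀ t < m, ∀ i, i ∉ N t → x t i = 0)
    (hxs : ∀ t < m, ∑ i, x t i = s t * d t) :
    ∀ t ≤ m, ∀ k, s t ≤ k → k ≤ n → ∃ K, N t ⊆ K ∧ K.card = k ∧
      ∑ r ∈ Finset.range t, d r * min (k : ℝ) (s r) ≤
        ∑ i ∈ K, (∑ r ∈ Finset.range t, x r) i := by
  have hcard : ∀ t, (N t).card = s t := fun t => by
    cases t with
    | zero => exact hN0
    | succ t => exact (hN t).card_eq
  -- Asking for `N t ⊆ K` ensures that `K` catches all of round `t`. The price is the restriction `s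
  -- t ≤ k`, void at the end when `s m = 0`.
  intro t
  induction t with
  | zero =>
    intro _ k hk hkn
    obtain ⟨K, hK, hKc⟩ := Finset.exists_superset_card_eq (s := N 0) (n := k)
      (by rw [hcard]; exact hk) (by simpa using hkn)
    exact ⟨K, hK, hKc, by simp⟩
  | succ t ih =>
    intro ht k hk hkn
    have hstep : ∀ K, N t ⊆ K → ∑ i ∈ K, (∑ r ∈ Finset.range (t + 1), x r) i =
        ∑ i ∈ K, (∑ r ∈ Finset.range t, x r) i + d t * s t := by
      intro K hK
      simp only [Finset.sum_range_succ, Pi.add_apply, Finset.sum_add_distrib]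
      congr 1
      rw [mul_comm, ← hxs t ht]
      exact Finset.sum_subset (Finset.subset_univ K) fun i _ hi =>
        hxN t ht i fun h => hi (hK h)
    rcases le_or_gt (s t) k with hkt | hkt
    · obtain ⟨K, hK, hKc, hle⟩ := ih (by omega) k hkt hkn
      refine ⟨K, (hN t).subset.trans hK, hKc, ?_⟩
      rw [hstep K hK, Finset.sum_range_succ, min_eq_right (a := (k : ℝ)) (by exact_mod_cast hkt)]
      linarith
    -- For `k < s t`, start from the bound on `N t` itself and pass to its `k` most loaded nodes,
    -- chosen to contain `N (t + 1)`.
    · obtain ⟨K₀, hK₀, hKc₀, hle⟩ := ih (by omega) (s t) le_rfl ((hs t.zero_le).trans hs0)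
      obtain rfl : N t = K₀ := Finset.eq_of_subset_of_card_le hK₀ (by rw [hKc₀, hcard])
      obtain ⟨K, hK, hKtop⟩ := (hN t).exists_between hk (by rw [hcard]; exact hkt.le)
      refine ⟨K, hK, hKtop.card_eq, ?_⟩
      have h1 := hKtop.card_mul_sum_le
      rw [hstep _ subset_rfl, hcard] at h1
      have hst : (0 : ℝ) < s t := by exact_mod_cast (Nat.zero_le k).trans_lt hkt
      refine le_of_mul_le_mul_left ?_ hst
      refine le_trans ?_ h1
      -- All earlier sizes are at least `s t > k`, so each term of the bound scales exactly by `k /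
      -- s t`, the factor lost in averaging.
      have h2 : ∀ r ≤ t, (s t : ℝ) * (d r * min (k : ℝ) (s r)) =
          k * (d r * min (s t : ℝ) (s r)) := by
        intro r hr
        have h3 : s t ≤ s r := hs hr
        rw [min_eq_left (by exact_mod_cast hkt.le.trans h3), min_eq_left (by exact_mod_cast h3)]
        ring
      rw [Finset.mul_sum, Finset.sum_congr rfl fun r hr =>
        h2 r (Nat.le_of_lt_succ (Finset.mem_range.1 hr)), ← Finset.mul_sum,
        Finset.sum_range_succ, min_self]
      exact mul_le_mul_of_nonneg_left (by linarith) (Nat.cast_nonneg k)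

/-! ### Measurable choice of the most loaded nodes -/

open Classical in
/-- A selection of `k` elements of `S` on which `v` is largest, depending on `v` only through
the comparisons `R i j ↔ v i ≤ v j` between its entries. -/
def selectTop {n : ℕ} (R : Fin n → Fin n → Prop) (S : Finset (Fin n)) (k : ℕ) :
    Finset (Fin n) :=
  if h : ∃ T ⊆ S, T.card = k ∧ ∀ i ∈ T, ∀ j ∈ S, j ∉ T → R j i then h.choose else ∅

theorem isTop_selectTop {n : ℕ} (v : Fin n → ℝ) (S : Finset (Fin n)) (k : ℕ)
    (hk : k ≤ S.card) : IsTop v S k (selectTop (fun i j => v i ≤ v j) S k) := by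
  obtain ⟨T, hT⟩ := exists_isTop v S k hk
  have h : ∃ T ⊆ S, T.card = k ∧ ∀ i ∈ T, ∀ j ∈ S, j ∉ T → v j ≤ v i :=
    ⟨T, hT.subset, hT.card_eq, hT.le⟩
  rw [selectTop, dif_pos h]
  exact ⟨h.choose_spec.1, h.choose_spec.2.1, h.choose_spec.2.2⟩

/-- The shrinking neighbourhoods of sizes `s 0, s 1, …`, where `v t` is the load before the
`t`-th arrival. -/
def chain {n : ℕ} (s : ℕ → ℕ) (v : ℕ → Fin n → ℝ) : ℕ → Finset (Fin n)
  | 0 => selectTop (fun i j => v 0 i ≤ v 0 j) Finset.univ (s 0)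
  | t + 1 => selectTop (fun i j => v (t + 1) i ≤ v (t + 1) j) (chain s v t) (s (t + 1))

theorem card_chain {n : ℕ} {s : ℕ → ℕ} (hs : Antitone s) (hs0 : s 0 ≤ n) (v : ℕ → Fin n → ℝ)
    (t : ℕ) : (chain s v t).card = s t := by
  induction t with
  | zero => exact (isTop_selectTop _ _ _ (by simpa using hs0)).card_eq
  | succ t ih => exact (isTop_selectTop _ _ _ (by rw [ih]; exact hs t.le_succ)).card_eq

theorem isTop_chain_succ {n : ℕ} {s : ℕ → ℕ} (hs : Antitone s) (hs0 : s 0 ≤ n)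
    (v : ℕ → Fin n → ℝ) (t : ℕ) :
    IsTop (v (t + 1)) (chain s v t) (s (t + 1)) (chain s v (t + 1)) :=
  isTop_selectTop _ _ _ (by rw [card_chain hs hs0]; exact hs t.le_succ)

theorem chain_antitone {n : ℕ} {s : ℕ → ℕ} (hs : Antitone s) (hs0 : s 0 ≤ n)
    (v : ℕ → Fin n → ℝ) : Antitone (chain s v) :=
  antitone_nat_of_succ_le fun t => (isTop_chain_succ hs hs0 v t).subset

theorem chain_congr {n : ℕ} (s : ℕ → ℕ) {v v' : ℕ → Fin n → ℝ} (t : ℕ)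
    (h : ∀ r ≤ t, v r = v' r) : chain s v t = chain s v' t := by
  induction t with
  | zero => rw [chain, chain, h 0 le_rfl]
  | succ t ih => rw [chain, chain, h (t + 1) le_rfl, ih fun r hr => h r (hr.trans t.le_succ)]

theorem measurable_le_pattern {Ω : Type*} [MeasurableSpace Ω] {n : ℕ} {v : Ω → Fin n → ℝ}
    (hv : Measurable v) : Measurable fun ω => fun i j => v ω i ≤ v ω j := by
  refine measurable_pi_iff.2 fun i => measurable_pi_iff.2 fun j => ?_
  exact (measurableSet_le ((measurable_pi_apply i).comp hv)
    ((measurable_pi_apply j).comp hv)).mem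

/-- There are finitely many comparison patterns, so every selection from a pattern is measurable and
only the pattern itself needs checking. -/
theorem measurable_chain {Ω : Type*} [MeasurableSpace Ω] {n : ℕ} (s : ℕ → ℕ)
    {v : Ω → ℕ → Fin n → ℝ} (hv : ∀ t, Measurable fun ω => v ω t) (t : ℕ) :
    Measurable[_, ⊤] fun ω => chain s (v ω) t := by
  let _ : MeasurableSpace (Finset (Fin n)) := ⊤
  have _ : DiscreteMeasurableSpace (Finset (Fin n)) := ⟨fun _ => trivial⟩
  induction t with
  | zero =>
    exact (Measurable.of_discrete (f := fun R => selectTop R Finset.univ (s 0))).comp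
      (measurable_le_pattern (hv 0))
  | succ t ih =>
    exact (Measurable.of_discrete (f := fun p : (Fin n → Fin n → Prop) × Finset (Fin n) =>
      selectTop p.1 p.2 (s (t + 1)))).comp ((measurable_le_pattern (hv (t + 1))).prodMk ih)

/-! ### The measurable space of online nodes -/

theorem measurable_request {Ω : Type*} [MeasurableSpace Ω] {n : ℕ} {f : Ω → Request n}
    (h1 : Measurable[_, ⊤] fun ω => (f ω).nbrs) (h2 : Measurable fun ω => (f ω).quantity) :
    Measurable f := by
  rw [measurable_iff_comap_le]
  change MeasurableSpace.comap f (_ ⊔ _) ≤ _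
  rw [MeasurableSpace.comap_sup, MeasurableSpace.comap_comp, MeasurableSpace.comap_comp]
  exact sup_le h1.comap_le h2.comap_le

theorem measurable_nbrs (n : ℕ) : Measurable[_, ⊤] (Request.nbrs (n := n)) :=
  measurable_iff_comap_le.2 le_sup_left

theorem measurable_quantity (n : ℕ) : Measurable (Request.quantity (n := n)) :=
  measurable_iff_comap_le.2 le_sup_right

theorem measurableSet_request_eq {Ω : Type*} [MeasurableSpace Ω] {n : ℕ} {f g : Ω → Request n}
    (hf : Measurable f) (hg : Measurable g) : MeasurableSet {ω | f ω = g ω} := by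
  let _ : MeasurableSpace (Finset (Fin n)) := ⊤
  have _ : DiscreteMeasurableSpace (Finset (Fin n)) := ⟨fun _ => trivial⟩
  have : {ω | f ω = g ω} =
      {ω | (f ω).nbrs = (g ω).nbrs} ∩ {ω | (f ω).quantity = (g ω).quantity} := by
    ext ω
    simp only [Set.mem_ofPred_eq, Set.mem_inter_iff]
    refine ⟨fun h => by simp [h], fun h => ?_⟩
    cases hfω : f ω; cases hgω : g ω
    rw [hfω, hgω] at h
    simpa using h
  rw [this]
  exact (measurableSet_eq_fun ((measurable_nbrs n).comp hf) ((measurable_nbrs n).comp hg)).inter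
    (measurableSet_eq_fun ((measurable_quantity n).comp hf) ((measurable_quantity n).comp hg))

theorem measurableSet_mem_feasible {Ω : Type*} [MeasurableSpace Ω] {n : ℕ} {f : Ω → Request n}
    {x : Ω → Fin n → ℝ} (hf : Measurable f) (hx : Measurable x) :
    MeasurableSet {ω | x ω ∈ (f ω).feasible} := by
  let _ : MeasurableSpace (Finset (Fin n)) := ⊤
  have _ : DiscreteMeasurableSpace (Finset (Fin n)) := ⟨fun _ => trivial⟩
  have hxi : ∀ i, Measurable fun ω => x ω i := fun i => (measurable_pi_apply i).comp hx
  have hN : ∀ i, MeasurableSet {ω | i ∉ (f ω).nbrs} := fun i =>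
    ((measurable_nbrs n).comp hf) (MeasurableSet.of_discrete (s := {S | i ∉ S}))
  have h1 : MeasurableSet {ω | ∀ i, 0 ≤ x ω i} := by
    rw [Set.ofPred_forall]
    exact .iInter fun i => measurableSet_le measurable_const (hxi i)
  have h2 : MeasurableSet {ω | ∀ i, i ∉ (f ω).nbrs → x ω i = 0} := by
    rw [Set.ofPred_forall]
    refine .iInter fun i => ?_
    have : {ω | i ∉ (f ω).nbrs → x ω i = 0} = {ω | i ∉ (f ω).nbrs}ᶜ ∪ {ω | x ω i = 0} := by
      ext ω; simp only [Set.mem_ofPred_eq, Set.mem_union, Set.mem_compl_iff]; tauto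
    rw [this]
    exact (hN i).compl.union (measurableSet_eq_fun (hxi i) measurable_const)
  have h3 : MeasurableSet {ω | ∑ i, x ω i = (f ω).quantity} :=
    measurableSet_eq_fun (Finset.measurable_sum _ fun i _ => hxi i)
      ((measurable_quantity n).comp hf)
  exact h1.inter (h2.inter h3)

/-! ### Almost every play is feasible -/

/-- Induction over rounds: earlier rounds are inherited through the composition product, and the new
one is feasible by the policy's own guarantee. -/
theorem ae_playLaw {n m : ℕ} (A : Policy n) (E : AdaptiveSeq n m) (t : ℕ) (ht : t ≤ m) :
    ∀ᵐ h ∂(playLaw A E t ht), ∀ r : Fin t,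
      (h r).1 = E.next (Fin.castLE ht r) (fun s => h (Fin.castLE r.isLt.le s)) ∧
        (h r).2 ∈ (h r).1.feasible := by
  have hmeas : ∀ (t : ℕ) (ht : t ≤ m), MeasurableSet {h : History n t | ∀ r : Fin t,
      (h r).1 = E.next (Fin.castLE ht r) (fun s => h (Fin.castLE r.isLt.le s)) ∧
        (h r).2 ∈ (h r).1.feasible} := by
    intro t ht
    rw [Set.ofPred_forall]
    refine .iInter fun r => ?_
    have h1 : Measurable fun h : History n t => (h r).1 := (measurable_pi_apply r).fst
    have h2 : Measurable fun h : History n t => (h r).2 := (measurable_pi_apply r).snd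
    exact (measurableSet_request_eq h1 ((E.measurable_next _).comp
      (measurable_pi_iff.2 fun s => measurable_pi_apply _))).inter
        (measurableSet_mem_feasible h1 h2)
  induction t with
  | zero => exact Filter.Eventually.of_forall fun h r => r.elim0
  | succ t ih =>
    have ht' : t ≤ m := Nat.le_of_succ_le ht
    have := isProbabilityMeasure_playLaw A E t ht'
    have := A.isMarkov t
    set κ := (A.kernel t).comap (fun h => (h, E.next ⟨t, ht⟩ h))
      (measurable_id.prodMk (E.measurable_next ⟨t, ht⟩)) with hκ
    have hsnoc : Measurable fun p : History n t × (Fin n → ℝ) =>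
        (Fin.snoc p.1 (E.next ⟨t, ht⟩ p.1, p.2) : History n (t + 1)) := by
      refine measurable_pi_iff.2 fun i => ?_
      refine Fin.lastCases ?_ (fun j => ?_) i
      · simp only [Fin.snoc_last]
        exact ((E.measurable_next ⟨t, ht⟩).comp measurable_fst).prodMk measurable_snd
      · simp only [Fin.snoc_castSucc]
        exact (measurable_pi_apply j).comp measurable_fst
    have hfst : ∀ᵐ p ∂(playLaw A E t ht' ⊗ₘ κ), ∀ r : Fin t,
        (p.1 r).1 = E.next (Fin.castLE ht' r) (fun s => p.1 (Fin.castLE r.isLt.le s)) ∧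
          (p.1 r).2 ∈ (p.1 r).1.feasible := by
      refine (Measure.ae_compProd_iff (p := fun p : History n t × (Fin n → ℝ) => ∀ r : Fin t,
        (p.1 r).1 = E.next (Fin.castLE ht' r) (fun s => p.1 (Fin.castLE r.isLt.le s)) ∧
          (p.1 r).2 ∈ (p.1 r).1.feasible) (measurable_fst (hmeas t ht'))).2 ?_
      filter_upwards [ih ht'] with h hh
      exact Filter.Eventually.of_forall fun _ => hh
    have hsnd : ∀ᵐ p ∂(playLaw A E t ht' ⊗ₘ κ), p.2 ∈ (E.next ⟨t, ht⟩ p.1).feasible := by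
      refine (Measure.ae_compProd_iff (p := fun p : History n t × (Fin n → ℝ) =>
        p.2 ∈ (E.next ⟨t, ht⟩ p.1).feasible) (measurableSet_mem_feasible
          ((E.measurable_next _).comp measurable_fst) measurable_snd)).2 ?_
      refine Filter.Eventually.of_forall fun h => ?_
      rw [hκ, Kernel.comap_apply]
      exact A.feasible t h _
    rw [playLaw, ae_map_iff hsnoc.aemeasurable (hmeas (t + 1) ht)]
    filter_upwards [hfst, hsnd] with p h1 h2 r
    have hlast : ∀ (j : Fin (t + 1)) (hj : (j : ℕ) < t),
        (Fin.snoc p.1 (E.next ⟨t, ht⟩ p.1, p.2) : History n (t + 1)) j = p.1 ⟨j, hj⟩ :=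
      fun j hj => Fin.snoc_castSucc (α := fun _ => Request n × (Fin n → ℝ)) _ _ ⟨j, hj⟩
    refine Fin.lastCases ?_ (fun j => ?_) r
    · simp only [Fin.snoc_last]
      refine ⟨?_, h2⟩
      change E.next ⟨t, ht⟩ p.1 = E.next ⟨t, ht⟩ _
      congr 1
      funext s
      exact (hlast (Fin.castLE (Nat.le_succ t) s) s.isLt).symm
    · simp only [Fin.snoc_castSucc]
      refine ⟨(h1 j).1.trans ?_, (h1 j).2⟩
      change E.next ⟨j, _⟩ _ = E.next ⟨j, _⟩ _
      congr 1
      funext s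
      exact (hlast (Fin.castLE (j.isLt.le.trans t.le_succ) s) (s.isLt.trans j.isLt)).symm

theorem ae_isPlay {n m : ℕ} (A : Policy n) (E : AdaptiveSeq n m) :
    ∀ᵐ h ∂(playLaw A E m le_rfl), E.IsPlay h := ae_playLaw A E m le_rfl

/-! ### The shrinking adversary -/

/-- The allocation of round `r` of a history, zero after its end. -/
def History.alloc {n T : ℕ} (h : History n T) (r : ℕ) : Fin n → ℝ :=
  if hr : r < T then (h ⟨r, hr⟩).2 else 0

/-- The load vector after the first `t` rounds of a history. -/
def History.loadBefore {n T : ℕ} (h : History n T) (t : ℕ) : Fin n → ℝ :=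
  ∑ r ∈ Finset.range t, h.alloc r

theorem History.alloc_coe {n T : ℕ} (h : History n T) (r : Fin T) : h.alloc r = (h r).2 := by
  simp [History.alloc]

theorem History.loadBefore_eq_load {n m : ℕ} (h : History n m) : h.loadBefore m = h.load := by
  rw [History.loadBefore, ← Fin.sum_univ_eq_sum_range, History.load]
  exact Finset.sum_congr rfl fun r _ => h.alloc_coe r

theorem History.measurable_loadBefore {n T : ℕ} (t : ℕ) :
    Measurable fun h : History n T => h.loadBefore t := by
  refine Finset.measurable_sum _ fun r _ => ?_
  unfold History.alloc
  split_ifs with hr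
  · exact (measurable_pi_apply _).snd
  · exact measurable_const

theorem History.loadBefore_castLE {n T t : ℕ} (h : History n T) (htT : t ≤ T) (r : ℕ)
    (hr : r ≤ t) :
    History.loadBefore (fun s : Fin t => h (Fin.castLE htT s)) r = h.loadBefore r := by
  refine Finset.sum_congr rfl fun k hk => ?_
  have hk' : k < t := (Finset.mem_range.1 hk).trans_le hr
  simp [History.alloc, hk', hk'.trans_le htT]

/-- The adaptive request sequence with prescribed quantities `p` which shrinks the previous
neighbourhood to its `s t` most loaded nodes. -/
def shrinkSeq {n m : ℕ} (s : ℕ → ℕ) (p : ℕ → ℝ) (hs : Antitone s) (hs0 : s 0 ≤ n)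
    (hpos : ∀ t < m, 0 < s t) (hp : ∀ t < m, 0 < p t) : AdaptiveSeq n m where
  next t h :=
    { nbrs := chain s h.loadBefore t
      quantity := p t
      nonempty := by
        rw [← Finset.card_pos, card_chain hs hs0]
        exact hpos t t.isLt
      pos := hp t t.isLt }
  measurable_next t := measurable_request
    (measurable_chain s (fun r => History.measurable_loadBefore r) t) measurable_const

/-- The neighbourhood of round `t` uses only loads before `t`, so it can be read off the complete
play. -/
theorem isPlay_shrinkSeq {n m : ℕ} {s : ℕ → ℕ} {p : ℕ → ℝ} {hs : Antitone s} {hs0 : s 0 ≤ n}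
    {hpos : ∀ t < m, 0 < s t} {hp : ∀ t < m, 0 < p t} {h : History n m}
    (hplay : (shrinkSeq s p hs hs0 hpos hp).IsPlay h) (t : Fin m) :
    (h t).1.nbrs = chain s h.loadBefore t ∧ (h t).1.quantity = p t := by
  rw [(hplay t).1]
  exact ⟨chain_congr s t fun r hr => h.loadBefore_castLE t.isLt.le r hr, rfl⟩

theorem exists_adaptiveSeq_majorizes (n m : ℕ) (q : ℝ) (hq : 0 < q) (A : Policy n)
    (E : RequestSeq n m) (hE : E.total = q) :
    ∃ E' : AdaptiveSeq n m, E'.HasTotal q ∧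
      ∀ᵐ h ∂(playLaw A E' m le_rfl),
        Majorizes h.load (waterFilling E) ∧
          Majorizes (opt E)
            (opt h.requests) := by
  obtain ⟨θ, hθ, h0, hw, hmax⟩ := exists_ladder_waterFilling E (hE ▸ hq)
  set w := waterFilling E with hwdef
  set s : ℕ → ℕ := fun t => (upper θ w t).card with hsdef
  set p : ℕ → ℝ := fun t => s t * (θ (t + 1) - θ t) with hpdef
  have hs : Antitone s := fun a b hab => Finset.card_le_card (upper_antitone hθ w hab)
  have hs0 : s 0 ≤ n := by simpa using (upper θ w 0).card_le_univ
  have hpos : ∀ t < m, 0 < s t := by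
    intro t ht
    obtain ⟨i, hi⟩ := hmax
    refine Finset.card_pos.2 ⟨i, ?_⟩
    simpa [upper, hi] using hθ.monotone (Nat.succ_le_of_lt ht)
  have hp : ∀ t < m, 0 < p t := fun t ht =>
    mul_pos (by exact_mod_cast hpos t ht) (sub_pos.2 (hθ t.lt_succ_self))
  -- Since `θ (m + 1)` exceeds all loads, the final bound applies to sets of every size.
  have hsm : s m = 0 := by
    refine Finset.card_eq_zero.2 (Finset.filter_eq_empty_iff.2 fun i _ => not_le.2 ?_)
    obtain ⟨r, hr, h⟩ := hw i
    rw [h]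
    exact hθ (Nat.lt_succ_of_le hr)
  have htot : ∑ t : Fin m, p t = q := by
    rw [Fin.sum_univ_eq_sum_range p, ← hE, ← sum_waterFilling, ← hwdef,
      sum_eq_sum_card_inter hθ h0 hw]
    simp only [Finset.univ_inter, hpdef, hsdef]
  have hTotal : (shrinkSeq s p hs hs0 hpos hp).HasTotal q := by
    intro h hplay
    rw [← htot]
    exact Finset.sum_congr rfl fun t _ => (isPlay_shrinkSeq hplay t).2
  refine ⟨shrinkSeq s p hs hs0 hpos hp, hTotal, ?_⟩
  -- From here on the argument is deterministic, for one fixed feasible play.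
  filter_upwards [ae_isPlay A (shrinkSeq s p hs hs0 hpos hp)] with h hplay
  have hN := isPlay_shrinkSeq hplay
  set N := chain s h.loadBefore with hNdef
  constructor
  · rw [majorizes_iff_sets]
    constructor
    · rw [sum_waterFilling, hE, ← hTotal h hplay]
      simp only [History.load, Finset.sum_apply]
      rw [Finset.sum_comm]
      exact Finset.sum_congr rfl fun t _ => (hplay t).2.2.2
    · intro K
      obtain ⟨K', -, hK', hle⟩ := exists_sum_ge_of_isTop (m := m) s
        (fun t => θ (t + 1) - θ t) hs hs0 N h.alloc (card_chain hs hs0 _ 0)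
        (isTop_chain_succ hs hs0 h.loadBefore)
        (fun t ht i hi => by
          rw [h.alloc_coe ⟨t, ht⟩]
          exact (hplay ⟨t, ht⟩).2.2.1 i (by rw [(hN ⟨t, ht⟩).1]; exact hi))
        (fun t ht => by
          rw [h.alloc_coe ⟨t, ht⟩, (hplay ⟨t, ht⟩).2.2.2, (hN ⟨t, ht⟩).2])
        m le_rfl K.card (by rw [hsm]; exact Nat.zero_le _) (by simpa using K.card_le_univ)
      refine ⟨K', hK', (sum_le_sum_min_card hθ h0 hw K).trans (hle.trans ?_)⟩
      rw [← h.loadBefore_eq_load]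
      exact le_rfl
  · obtain ⟨z, hz, hzf⟩ := exists_slice_allocation E hθ h0 hw
      (Classical.choose_spec (exists_opt E)).1
    obtain ⟨σ, hσ⟩ := exists_perm_of_card_eq N (upper θ w) (chain_antitone hs hs0 _)
      (upper_antitone hθ w) m (fun t _ => card_chain hs hs0 _ t)
    -- Relabelled by `σ`, the slice allocation of `opt E` is feasible for the realized requests, so
    -- it majorizes their optimum.
    refine Majorizes.of_comp_perm σ ((Classical.choose_spec (exists_opt h.requests)).2 _
      ⟨fun t i => z t (σ i), fun t => ⟨fun i => (hzf t).1 _, fun i hi => ?_, ?_⟩, ?_⟩)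
    · refine (hzf t).2.1 _ fun h' => hi ?_
      change i ∈ (h t).1.nbrs
      rw [(hN t).1]
      exact (hσ t t.isLt i).1 h'
    · rw [Equiv.sum_comp σ (z t), (hzf t).2.2]
      exact (hN t).2.symm
    · funext i
      change opt E (σ i) = _
      rw [show opt E = ∑ r, z r from hz]
      simp

end

end OnlineAllocation

theorem mainTheorem7 (n m : ℕ) (q : ℝ) (hq : 0 < q) (A : OnlineAllocation.Policy n)
    (E : OnlineAllocation.RequestSeq n m) (hE : E.total = q) :
    ∃ E' : OnlineAllocation.AdaptiveSeq n m, E'.HasTotal q ∧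
      ∀ᵐ h ∂(OnlineAllocation.playLaw A E' m le_rfl),
        OnlineAllocation.Majorizes h.load (OnlineAllocation.waterFilling E) ∧
          OnlineAllocation.Majorizes (OnlineAllocation.opt E)
            (OnlineAllocation.opt h.requests) :=
  OnlineAllocation.exists_adaptiveSeq_majorizes n m q hq A E hE
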